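/- An MV-algebra is a set $A$ with a binary operation $\oplus$, a unary operation $\neg$ and a constant $0$ such that $(A,\oplus,0)$ is a commutative monoid, $\neg\neg x=x$, $x\oplus\neg 0=\neg 0$ and $\neg(\neg x\oplus y)\oplus y=\neg(\neg y\oplus x)\oplus x$. Put $1=\neg 0$, $x\ominus y=\neg(\neg x\oplus y)$, $d(x,y)=(x\ominus y)\oplus(y\ominus x)$, let $nx$ be the $n$-fold sum $x\oplus\cdots\oplus x$, and let $\vee,\wedge$ be the lattice operations of the order $x\le y\iff\exists z\;x\oplus z=y$. An ideal of $A$ is a subset containing $0$, closed under $\oplus$ and downward closed. An ideal $P$ is prime if $1\notin P$ and for all $x,y\in A$ one has $x\ominus y\in P$ or $y\ominus x\in P$. The quotient $A/P$ is by the congruence $x\sim y\iff d(x,y)\in P$, and the class of $a$ is written $[a]_P$. The algebra $A$ is hyperarchimedean if for every $a\in A$ there is an integer $n\ge 1$ with $na=(n+1)a$. Let $Z_A$ be the set of prime ideals of $A$ with the topology that has the sets $W_a=\{P : a\in P\}$ ($a\in A$) as a base. Let $E_A=\bigsqcup_{P\in Z_A}A/P$ with the projection $E_A\to Z_A$; for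 $a\in A$ let $\widehat a:Z_A\to E_A$, $\widehat a(P)=([a]_P,P)$, and give $E_A$ the topology that has the sets $\widehat a(W_b)$ ($a,b\in A$) as a base. Let $\Gamma(Z_A,E_A)$ be the MV-algebra, with pointwise operations, of continuous global sections of $E_A\to Z_A$. Theorem. Let $A$ be a hyperarchimedean MV-algebra. Then the morphism $\eta:A\to\Gamma(Z_A,E_A)$, $\eta(a)=\widehat a$, is an isomorphism of MV-algebras. Moreover, let $a_1,a_2\in A$. Then there is an integer $n\ge 1$ such that $na_1=(n+1)a_1$ and $na_2=(n+1)a_2$; and for every such $n$ and all $b_1,b_2\in A$ such that $\widehat{b_1}=\widehat{b_2}$ on $W_{a_1}\cap W_{a_2}$, the element $$b=(b_1\wedge b_2)\vee(na_1\wedge b_2)\vee(na_2\wedge b_1)$$ satisfies $\widehat b=\widehat{b_1}$ on $W_{a_1}$ and $\widehat b=\widehat{b_2}$ on $W_{a_2}$. -/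

import Mathlib

/-- An MV-algebra.  The operation `⊕` is written `+`, the negation `¬` is `MVAlgebra.neg`, and
`n x = x ⊕ ⋯ ⊕ x` (`n` times) is `n • x`. -/
class MVAlgebra (A : Type*) extends AddCommMonoid A where
  /-- the negation -/
  neg : A → A
  neg_neg' : ∀ x : A, neg (neg x) = x
  add_neg_zero' : ∀ x : A, x + neg 0 = neg 0
  lukasiewicz' : ∀ x y : A, neg (neg x + y) + y = neg (neg y + x) + x

namespace MVAlgebra

variable {A : Type*} [MVAlgebra A]

/-- `1 = ¬ 0` -/
instance : One A := ⟨neg 0⟩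

/-- `x ⊙ y = ¬ (¬ x ⊕ ¬ y)` -/
def odot (x y : A) : A := neg (neg x + neg y)

/-- `x ⊖ y = x ⊙ ¬ y` -/
def ominus (x y : A) : A := odot x (neg y)

/-- the distance `d(x, y) = (x ⊖ y) ⊕ (y ⊖ x)` -/
def dist (x y : A) : A := ominus x y + ominus y x

theorem ominus_eq (x y : A) : ominus x y = neg (neg x + y) := by
  simp only [ominus, odot, neg_neg']

theorem add_one' (x : A) : x + 1 = 1 := add_neg_zero' x

theorem neg_one' : neg (1 : A) = 0 := neg_neg' 0

theorem neg_add_self' (x : A) : neg x + x = 1 := by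
  have h := lukasiewicz' x (neg 0)
  rw [add_neg_zero', neg_neg', zero_add] at h
  exact h.symm

/-- `x ≤ y` iff `x ⊕ z = y` for some `z` -/
instance : LE A := ⟨fun x y => ∃ z, x + z = y⟩

theorem le_def' {x y : A} : x ≤ y ↔ ∃ z, x + z = y := Iff.rfl

theorem le_iff_neg_add {x y : A} : x ≤ y ↔ neg x + y = 1 := by
  constructor
  · rintro ⟨z, rfl⟩
    rw [← add_assoc, neg_add_self', add_comm, add_one']
  · intro h
    refine ⟨neg (neg y + x), ?_⟩
    rw [add_comm, ← lukasiewicz' x y, h, neg_one', zero_add]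

instance : PartialOrder A where
  le_refl x := ⟨0, add_zero x⟩
  le_trans := by
    rintro x _ _ ⟨u, rfl⟩ ⟨v, rfl⟩
    exact ⟨u + v, (add_assoc x u v).symm⟩
  le_antisymm x y h₁ h₂ := by
    have h := lukasiewicz' x y
    rw [le_iff_neg_add.1 h₁, le_iff_neg_add.1 h₂, neg_one', zero_add, zero_add] at h
    exact h.symm

theorem add_le_add'' {x y u v : A} (h₁ : x ≤ y) (h₂ : u ≤ v) : x + u ≤ y + v := by
  obtain ⟨z, rfl⟩ := h₁
  obtain ⟨w, rfl⟩ := h₂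
  exact ⟨z + w, by abel⟩

theorem neg_le_neg'' {x y : A} (h : x ≤ y) : neg y ≤ neg x := by
  rw [le_iff_neg_add, neg_neg', add_comm]
  exact le_iff_neg_add.1 h

theorem ominus_le_iff {x y w : A} : ominus x y ≤ w ↔ x ≤ w + y := by
  rw [le_iff_neg_add, le_iff_neg_add, ominus_eq, neg_neg', add_assoc, add_comm y w]

theorem le_ominus_add (x y : A) : x ≤ ominus x y + y := ominus_le_iff.1 le_rfl

theorem ominus_add_comm (x y : A) : ominus x y + y = ominus y x + x := by
  rw [ominus_eq, ominus_eq, lukasiewicz']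

theorem ominus_add_le {x y z : A} (h₁ : x ≤ z) (h₂ : y ≤ z) : ominus x y + y ≤ z := by
  have hz : ominus z y + y = z := by
    rw [ominus_add_comm, ominus_eq, le_iff_neg_add.1 h₂, neg_one', zero_add]
  rw [← hz]
  refine add_le_add'' ?_ le_rfl
  rw [ominus_eq, ominus_eq]
  exact neg_le_neg'' (add_le_add'' (neg_le_neg'' h₁) le_rfl)

/-- The lattice structure of the natural order: `x ∨ y = (x ⊖ y) ⊕ y` and
`x ∧ y = ¬ (¬ x ∨ ¬ y)`. -/
instance : Lattice A where
  sup x y := ominus x y + y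
  le_sup_left x y := le_ominus_add x y
  le_sup_right x y := ⟨ominus x y, add_comm _ _⟩
  sup_le _ _ _ h₁ h₂ := ominus_add_le h₁ h₂
  inf x y := neg (ominus (neg x) (neg y) + neg y)
  inf_le_left x y := by
    have h := neg_le_neg'' (le_ominus_add (neg x) (neg y))
    rwa [neg_neg'] at h
  inf_le_right x y := by
    have h : neg y ≤ ominus (neg x) (neg y) + neg y :=
      ⟨ominus (neg x) (neg y), add_comm _ _⟩
    have h := neg_le_neg'' h
    rwa [neg_neg'] at h
  le_inf x y z h₁ h₂ := by
    have h := neg_le_neg'' (ominus_add_le (neg_le_neg'' h₁) (neg_le_neg'' h₂))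
    rwa [neg_neg'] at h

theorem ominus_self (x : A) : ominus x x = 0 := by
  rw [ominus_eq, neg_add_self', neg_one']

theorem dist_self (x : A) : dist x x = 0 := by
  rw [dist, ominus_self, add_zero]

theorem dist_comm (x y : A) : dist x y = dist y x := add_comm _ _

theorem ominus_triangle (x y z : A) : ominus x z ≤ ominus x y + ominus y z := by
  rw [ominus_le_iff, add_assoc]
  exact (le_ominus_add x y).trans (add_le_add'' le_rfl (le_ominus_add y z))

theorem dist_triangle (x y z : A) : dist x z ≤ dist x y + dist y z := by
  have h := add_le_add'' (ominus_triangle x y z) (ominus_triangle z y x)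
  refine h.trans (le_of_eq ?_)
  simp only [dist]
  abel

theorem ominus_add_add_le (x y u v : A) :
    ominus (x + u) (y + v) ≤ ominus x y + ominus u v := by
  rw [ominus_le_iff]
  refine (add_le_add'' (le_ominus_add x y) (le_ominus_add u v)).trans (le_of_eq ?_)
  abel

theorem dist_add_add_le (x y u v : A) : dist (x + u) (y + v) ≤ dist x y + dist u v := by
  have h := add_le_add'' (ominus_add_add_le x y u v) (ominus_add_add_le y x v u)
  refine h.trans (le_of_eq ?_)
  simp only [dist]
  abel

theorem dist_neg_neg (x y : A) : dist (neg x) (neg y) = dist x y := by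
  simp only [dist, ominus_eq, neg_neg']
  rw [add_comm x (neg y), add_comm y (neg x), add_comm]

end MVAlgebra

/-- An ideal of an MV-algebra. -/
structure MVIdeal (A : Type*) [MVAlgebra A] where
  /-- the underlying set -/
  carrier : Set A
  zero_mem' : 0 ∈ carrier
  mem_of_le' : ∀ x y : A, x ∈ carrier → y ≤ x → y ∈ carrier
  add_mem' : ∀ x y : A, x ∈ carrier → y ∈ carrier → x + y ∈ carrier

namespace MVIdeal

variable {A : Type*} [MVAlgebra A]

instance : Membership A (MVIdeal A) := ⟨fun I x => x ∈ I.carrier⟩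

/-- An ideal `P` is prime if `1 ∉ P` and, for all `x, y`, `x ⊖ y ∈ P` or `y ⊖ x ∈ P`. -/
def IsPrime (P : MVIdeal A) : Prop :=
  (1 : A) ∉ P ∧ ∀ x y : A, MVAlgebra.ominus x y ∈ P ∨ MVAlgebra.ominus y x ∈ P

/-- The congruence of an ideal `I`: `x ∼ y` iff `d(x, y) ∈ I`. -/
def con (I : MVIdeal A) : AddCon A where
  r x y := MVAlgebra.dist x y ∈ I
  iseqv :=
    { refl := fun x => by
        rw [MVAlgebra.dist_self]
        exact I.zero_mem'
      symm := fun {x y} h => by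
        rw [MVAlgebra.dist_comm]
        exact h
      trans := fun {x y z} h₁ h₂ =>
        I.mem_of_le' _ _ (I.add_mem' _ _ h₁ h₂) (MVAlgebra.dist_triangle x y z) }
  add' := fun {x y u v} h₁ h₂ =>
    I.mem_of_le' _ _ (I.add_mem' _ _ h₁ h₂) (MVAlgebra.dist_add_add_le x y u v)

/-- The quotient `A / I`. -/
def Quot (I : MVIdeal A) : Type _ := I.con.Quotient

instance (I : MVIdeal A) : AddCommMonoid I.Quot :=
  inferInstanceAs (AddCommMonoid I.con.Quotient)

/-- The class `[a]_I`. -/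
def cls (I : MVIdeal A) (a : A) : I.Quot := (a : I.con.Quotient)

theorem cls_eq_cls {I : MVIdeal A} {a b : A} :
    I.cls a = I.cls b ↔ MVAlgebra.dist a b ∈ I := AddCon.eq I.con

theorem cls_surjective (I : MVIdeal A) : Function.Surjective I.cls := by
  intro q
  induction q using AddCon.induction_on with
  | H a => exact ⟨a, rfl⟩

theorem cls_add (I : MVIdeal A) (a b : A) : I.cls (a + b) = I.cls a + I.cls b := rfl

theorem cls_zero (I : MVIdeal A) : I.cls 0 = 0 := rfl

/-- The negation of `A / I`: `¬ [a] = [¬ a]`. -/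
def quotNeg (I : MVIdeal A) : I.Quot → I.Quot :=
  Quotient.lift (fun a => I.cls (MVAlgebra.neg a)) (by
    intro a b h
    refine cls_eq_cls.2 ?_
    rw [MVAlgebra.dist_neg_neg]
    exact h)

instance (I : MVIdeal A) : MVAlgebra I.Quot where
  neg := I.quotNeg
  neg_neg' := by
    intro x
    obtain ⟨a, rfl⟩ := I.cls_surjective x
    exact congrArg I.cls (MVAlgebra.neg_neg' a)
  add_neg_zero' := by
    intro x
    obtain ⟨a, rfl⟩ := I.cls_surjective x
    exact congrArg I.cls (MVAlgebra.add_neg_zero' a)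
  lukasiewicz' := by
    intro x y
    obtain ⟨a, rfl⟩ := I.cls_surjective x
    obtain ⟨b, rfl⟩ := I.cls_surjective y
    exact congrArg I.cls (MVAlgebra.lukasiewicz' a b)

theorem cls_neg (I : MVIdeal A) (a : A) :
    I.cls (MVAlgebra.neg a) = MVAlgebra.neg (I.cls a) := rfl

end MVIdeal

/-- A morphism of MV-algebras. -/
structure MVHom (A B : Type*) [MVAlgebra A] [MVAlgebra B] where
  /-- the underlying function -/
  toFun : A → B
  map_zero' : toFun 0 = 0
  map_add' : ∀ x y : A, toFun (x + y) = toFun x + toFun y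
  map_neg' : ∀ x : A, toFun (MVAlgebra.neg x) = MVAlgebra.neg (toFun x)

/-- A morphism of MV-algebras is an isomorphism if it has a two-sided inverse morphism. -/
def MVHom.IsIso {A B : Type*} [MVAlgebra A] [MVAlgebra B] (f : MVHom A B) : Prop :=
  ∃ g : MVHom B A, (∀ a : A, g.toFun (f.toFun a) = a) ∧ ∀ b : B, f.toFun (g.toFun b) = b

/-- An MV-algebra is hyperarchimedean if each element `a` satisfies `n a = (n + 1) a` for some
integer `n ≥ 1`. -/
def MVAlgebra.IsHyperarchimedean (A : Type*) [MVAlgebra A] : Prop :=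
  ∀ a : A, ∃ n : ℕ, 1 ≤ n ∧ n • a = (n + 1) • a

/-- The set of points of `Z_A`: the prime ideals of `A`. -/
def PrimeSpec (A : Type*) [MVAlgebra A] : Type _ := {P : MVIdeal A // P.IsPrime}

namespace PrimeSpec

variable {A : Type*} [MVAlgebra A]

/-- The basic open set `W_a = {P | a ∈ P}`. -/
def W (a : A) : Set (PrimeSpec A) := {P | a ∈ P.1}

/-- The coZariski topology, with base the sets `W_a`. -/
instance : TopologicalSpace (PrimeSpec A) :=
  TopologicalSpace.generateFrom (Set.range W)

theorem W_inter (a b : A) : W a ∩ W b = W (a + b) := by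
  ext P
  constructor
  · rintro ⟨h₁, h₂⟩
    exact P.1.add_mem' _ _ h₁ h₂
  · intro h
    exact ⟨P.1.mem_of_le' _ _ h ⟨b, rfl⟩, P.1.mem_of_le' _ _ h ⟨a, add_comm _ _⟩⟩

theorem W_zero : W (0 : A) = Set.univ := Set.eq_univ_of_forall fun P => P.1.zero_mem'

theorem isOpen_W (a : A) : IsOpen (W a) :=
  TopologicalSpace.isOpen_generateFrom_of_mem ⟨a, rfl⟩

theorem isTopologicalBasis_W :
    TopologicalSpace.IsTopologicalBasis (Set.range (W : A → Set (PrimeSpec A))) where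
  exists_subset_inter := by
    rintro _ ⟨a, rfl⟩ _ ⟨b, rfl⟩ P hP
    exact ⟨W (a + b), ⟨a + b, rfl⟩, by rwa [← W_inter], (W_inter a b).ge⟩
  sUnion_eq := Set.eq_univ_of_forall fun P =>
    ⟨W 0, ⟨0, rfl⟩, by rw [W_zero]; trivial⟩
  eq_generateFrom := rfl

end PrimeSpec

/-- The étale space `E_A`: the disjoint union of the quotients `A / P`, for `P` prime. -/
def EtaleSpec (A : Type*) [MVAlgebra A] : Type _ := Σ P : PrimeSpec A, P.1.Quot

namespace EtaleSpec

variable {A : Type*} [MVAlgebra A]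

/-- The section `â : Z_A → E_A`, `â(P) = [a]_P`. -/
def hat (a : A) (P : PrimeSpec A) : EtaleSpec A := ⟨P, P.1.cls a⟩

/-- The topology of `E_A`, with base the sets `â(W_b)`. -/
instance : TopologicalSpace (EtaleSpec A) :=
  TopologicalSpace.generateFrom {s | ∃ a b : A, s = hat a '' PrimeSpec.W b}

/-- The set-theoretic section `Z_A → E_A` given by a choice of a point in each fibre. -/
def sectionOf (σ : ∀ P : PrimeSpec A, P.1.Quot) (P : PrimeSpec A) : EtaleSpec A := ⟨P, σ P⟩

/-- A section is continuous iff it is locally of the form `â`. -/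
theorem continuous_sectionOf_iff {σ : ∀ P : PrimeSpec A, P.1.Quot} :
    Continuous (sectionOf σ) ↔
      ∀ P : PrimeSpec A, ∃ a b : A, P ∈ PrimeSpec.W b ∧
        ∀ Q ∈ PrimeSpec.W b, σ Q = Q.1.cls a := by
  have key : ∀ (a b : A) (Q : PrimeSpec A),
      sectionOf σ Q ∈ hat a '' PrimeSpec.W b ↔ Q ∈ PrimeSpec.W b ∧ σ Q = Q.1.cls a := by
    intro a b Q
    constructor
    · rintro ⟨R, hR, h⟩
      obtain ⟨h₁, h₂⟩ := Sigma.mk.inj h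
      subst h₁
      exact ⟨hR, (eq_of_heq h₂).symm⟩
    · rintro ⟨hQ, h⟩
      exact ⟨Q, hQ, by rw [sectionOf, hat, h]⟩
  constructor
  · intro hσ P
    obtain ⟨a, ha⟩ := P.1.cls_surjective (σ P)
    have ho : IsOpen (sectionOf σ ⁻¹' (hat a '' PrimeSpec.W 0)) :=
      (TopologicalSpace.isOpen_generateFrom_of_mem ⟨a, 0, rfl⟩ :
        IsOpen (hat a '' PrimeSpec.W (0 : A))).preimage hσ
    have hP : P ∈ sectionOf σ ⁻¹' (hat a '' PrimeSpec.W 0) :=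
      (key a 0 P).2 ⟨P.1.zero_mem', ha.symm⟩
    obtain ⟨_, ⟨b, rfl⟩, hb, hsub⟩ :=
      PrimeSpec.isTopologicalBasis_W.exists_subset_of_mem_open hP ho
    exact ⟨a, b, hb, fun Q hQ => ((key a 0 Q).1 (hsub hQ)).2⟩
  · intro h
    refine continuous_generateFrom_iff.2 ?_
    rintro _ ⟨c, e, rfl⟩
    refine isOpen_iff_forall_mem_open.2 fun P hP => ?_
    obtain ⟨hPe, hPc⟩ := (key c e P).1 hP
    obtain ⟨a, b, hb, hab⟩ := h P
    refine ⟨(PrimeSpec.W b ∩ PrimeSpec.W e) ∩ PrimeSpec.W (MVAlgebra.dist a c), ?_, ?_, ?_⟩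
    · rintro Q ⟨⟨hQb, hQe⟩, hQ⟩
      exact (key c e Q).2 ⟨hQe, (hab Q hQb).trans (MVIdeal.cls_eq_cls.2 hQ)⟩
    · exact ((PrimeSpec.isOpen_W _).inter (PrimeSpec.isOpen_W _)).inter (PrimeSpec.isOpen_W _)
    · exact ⟨⟨hb, hPe⟩, MVIdeal.cls_eq_cls.1 ((hab P hb).symm.trans hPc)⟩

end EtaleSpec

/-- The set `Γ(Z_A, E_A)` of continuous global sections of `E_A → Z_A`; a section is given by its
value in each fibre `A / P`. -/
def GlobalSections (A : Type*) [MVAlgebra A] : Type _ :=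
  {σ : ∀ P : PrimeSpec A, P.1.Quot // Continuous (EtaleSpec.sectionOf σ)}

namespace GlobalSections

open EtaleSpec

variable {A : Type*} [MVAlgebra A]

theorem continuous_hat (a : A) :
    Continuous (sectionOf fun P : PrimeSpec A => P.1.cls a) :=
  continuous_sectionOf_iff.2 fun P => ⟨a, 0, P.1.zero_mem', fun _ _ => rfl⟩

theorem continuous_add {σ τ : ∀ P : PrimeSpec A, P.1.Quot}
    (hσ : Continuous (sectionOf σ)) (hτ : Continuous (sectionOf τ)) :
    Continuous (sectionOf fun P => σ P + τ P) := by
  refine continuous_sectionOf_iff.2 fun P => ?_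
  obtain ⟨a, b, hb, hab⟩ := continuous_sectionOf_iff.1 hσ P
  obtain ⟨c, e, he, hce⟩ := continuous_sectionOf_iff.1 hτ P
  refine ⟨a + c, b + e, ?_, fun Q hQ => ?_⟩
  · rw [← PrimeSpec.W_inter]
    exact ⟨hb, he⟩
  · rw [← PrimeSpec.W_inter] at hQ
    rw [hab Q hQ.1, hce Q hQ.2, MVIdeal.cls_add]

theorem continuous_neg {σ : ∀ P : PrimeSpec A, P.1.Quot}
    (hσ : Continuous (sectionOf σ)) :
    Continuous (sectionOf fun P => MVAlgebra.neg (σ P)) := by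
  refine continuous_sectionOf_iff.2 fun P => ?_
  obtain ⟨a, b, hb, hab⟩ := continuous_sectionOf_iff.1 hσ P
  exact ⟨MVAlgebra.neg a, b, hb, fun Q hQ => by rw [hab Q hQ, MVIdeal.cls_neg]⟩

instance : Zero (GlobalSections A) := ⟨⟨fun P => P.1.cls 0, continuous_hat 0⟩⟩

instance : Add (GlobalSections A) :=
  ⟨fun σ τ => ⟨fun P => σ.1 P + τ.1 P, continuous_add σ.2 τ.2⟩⟩

/-- The pointwise MV-algebra structure of `Γ(Z_A, E_A)`. -/
instance : MVAlgebra (GlobalSections A) where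
  neg σ := ⟨fun P => MVAlgebra.neg (σ.1 P), continuous_neg σ.2⟩
  add_assoc _ _ _ := Subtype.ext (funext fun _ => add_assoc _ _ _)
  zero_add _ := Subtype.ext (funext fun _ => zero_add _)
  add_zero _ := Subtype.ext (funext fun _ => add_zero _)
  add_comm _ _ := Subtype.ext (funext fun _ => add_comm _ _)
  nsmul := nsmulRec
  neg_neg' _ := Subtype.ext (funext fun _ => MVAlgebra.neg_neg' _)
  add_neg_zero' _ := Subtype.ext (funext fun _ => MVAlgebra.add_neg_zero' _)
  lukasiewicz' _ _ := Subtype.ext (funext fun _ => MVAlgebra.lukasiewicz' _ _)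

end GlobalSections

/-- The morphism `η : A → Γ(Z_A, E_A)`, `η(a)(P) = [a]_P`. -/
def MVAlgebra.eta (A : Type*) [MVAlgebra A] : MVHom A (GlobalSections A) where
  toFun a := ⟨fun P => P.1.cls a, GlobalSections.continuous_hat a⟩
  map_zero' := rfl
  map_add' _ _ := rfl
  map_neg' _ := rfl

/-!
The proof rests on two facts about an MV-algebra `A`.

* *Prime separation* (`MVIdeal.exists_isPrime`): an element outside an ideal `I` is outside some
  prime ideal containing `I`.  An ideal maximal with respect to excluding `a` is prime because
  multiples of `x ⊖ y` and of `y ⊖ x` have infimum `0`, so that `a` cannot lie in both of the ideals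
  obtained by adjoining these two elements.  Applied to the zero ideal, it says that `η` is
  injective.
* *Idempotents split the spectrum* (`PrimeSpec.mem_or_neg_mem`): if `f ⊕ f = f`, each prime ideal
  contains exactly one of `f`, `¬ f`.  If `n a = (n + 1) a`, then `n a` is idempotent and lies in the
  same prime ideals as `a`; so in a hyperarchimedean algebra each `W a` is clopen.

Surjectivity of `η` is the compactness of the spectrum combined with gluing over clopen sets, and the
two are carried out at once: for a continuous section `σ`, the elements `e` such that `σ` agrees with
some `â` off `W e` form an ideal (closure under `⊕` is gluing).  If this ideal were proper, it would
lie in a prime ideal `P`; but `σ` agrees with some `â` on a clopen neighbourhood `W f` of `P`, with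
`f` idempotent, so `¬ f` is in the ideal, hence in `P`, together with `f`.

The explicit gluing formula is checked in each quotient `A / P`, where `n a₁` and `n a₂` become `0`
or `1`.
-/

/-! ### Arithmetic and order in MV-algebras -/

namespace MVAlgebra

variable {A : Type*} [MVAlgebra A]

theorem zero_le' (x : A) : 0 ≤ x := ⟨x, zero_add x⟩

theorem le_one' (x : A) : x ≤ 1 := ⟨1, add_one' x⟩

theorem eq_zero_of_le_zero {x : A} (h : x ≤ 0) : x = 0 := le_antisymm h (zero_le' x)

theorem zero_inf' (x : A) : 0 ⊓ x = 0 := inf_eq_left.2 (zero_le' x)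

theorem one_inf' (x : A) : 1 ⊓ x = x := inf_eq_right.2 (le_one' x)

theorem zero_sup' (x : A) : 0 ⊔ x = x := sup_eq_right.2 (zero_le' x)

theorem sup_zero' (x : A) : x ⊔ 0 = x := sup_eq_left.2 (zero_le' x)

theorem ominus_le_self (x y : A) : ominus x y ≤ x :=
  ominus_le_iff.2 ⟨y, rfl⟩

theorem le_of_ominus_eq_zero {x y : A} (h : ominus x y = 0) : x ≤ y := by
  have h' := ominus_le_iff.1 h.le
  rwa [zero_add] at h'

theorem eq_of_dist_eq_zero {x y : A} (h : dist x y = 0) : x = y := by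
  have h₁ : ominus x y ≤ 0 := ⟨ominus y x, h⟩
  have h₂ : ominus y x ≤ 0 := ⟨ominus x y, (add_comm _ _).trans h⟩
  exact le_antisymm (le_of_ominus_eq_zero (eq_zero_of_le_zero h₁))
    (le_of_ominus_eq_zero (eq_zero_of_le_zero h₂))

theorem dist_zero (x : A) : dist x 0 = x := by
  rw [dist, ominus_eq, ominus_eq, add_zero, neg_neg', add_comm (neg 0), add_neg_zero']
  exact (congrArg (x + ·) (neg_neg' 0)).trans (add_zero x)

theorem ominus_ominus_self (x y : A) : ominus x (ominus x y) = x ⊓ y := by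
  rw [inf_comm]
  change _ = neg (ominus (neg y) (neg x) + neg x)
  rw [ominus_eq, ominus_eq, ominus_eq, neg_neg', add_comm (neg x), add_comm y]

theorem ominus_add_inf (x y : A) : ominus x y + x ⊓ y = x := by
  rw [← ominus_ominus_self, add_comm]
  exact le_antisymm (ominus_add_le le_rfl (ominus_le_self x y)) (le_ominus_add _ _)

theorem add_ominus_cancel_of_le_neg {w m : A} (h : w ≤ neg m) : ominus (w + m) m = w := by
  have h' := lukasiewicz' (neg w) m
  rw [add_comm (neg m), le_iff_neg_add.1 h, neg_one', zero_add, neg_neg'] at h'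
  rw [ominus_eq, h', neg_neg']

/-- The elements `x ⊖ y` and `y ⊖ x` are disjoint. -/
theorem eq_zero_of_le_ominus_of_le_ominus {w x y : A} (h₁ : w ≤ ominus x y)
    (h₂ : w ≤ ominus y x) : w = 0 := by
  have hx : w + x ⊓ y ≤ x :=
    (add_le_add'' h₁ le_rfl).trans (ominus_add_inf x y).le
  have hy : w + x ⊓ y ≤ y := by
    rw [inf_comm]
    exact (add_le_add'' h₂ le_rfl).trans (ominus_add_inf y x).le
  have hm : w + x ⊓ y = x ⊓ y := le_antisymm (le_inf hx hy) ⟨w, add_comm _ _⟩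
  -- `w ⊕ m = m` does not give `w = 0` without `w ≤ ¬ m`.
  have hw : w ≤ neg (x ⊓ y) := by
    refine h₁.trans (le_trans ?_ (neg_le_neg'' inf_le_right))
    rw [ominus_eq]
    exact neg_le_neg'' ⟨neg x, add_comm _ _⟩
  rw [← add_ominus_cancel_of_le_neg hw, hm, ominus_self]

theorem eq_zero_of_le_of_le_nsmul {u v : A} (h : ∀ w : A, w ≤ u → w ≤ v → w = 0) (n : ℕ) :
    ∀ w : A, w ≤ u → w ≤ n • v → w = 0 := by
  induction n with
  | zero =>
    intro w _ hw
    rw [zero_nsmul] at hw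
    exact eq_zero_of_le_zero hw
  | succ n ih =>
    intro w hu hw
    rw [succ_nsmul'] at hw
    exact ih w hu (le_of_ominus_eq_zero
      (h _ ((ominus_le_self _ _).trans hu) (ominus_le_iff.2 hw)))

/-- Multiples of `x ⊖ y` and of `y ⊖ x` are disjoint. -/
theorem eq_zero_of_le_nsmul_ominus {w x y : A} {m n : ℕ} (h₁ : w ≤ m • ominus x y)
    (h₂ : w ≤ n • ominus y x) : w = 0 :=
  eq_zero_of_le_of_le_nsmul (fun _ h h' =>
      eq_zero_of_le_of_le_nsmul (fun _ => eq_zero_of_le_ominus_of_le_ominus) n _ h' h)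
    m w h₂ h₁

theorem add_nsmul_eq_of_nsmul_eq {a : A} {n : ℕ} (h : n • a = (n + 1) • a) (k : ℕ) :
    (n + k) • a = n • a := by
  induction k with
  | zero => rfl
  | succ k ih => rw [← add_assoc, succ_nsmul, ih, ← succ_nsmul, ← h]

theorem nsmul_add_nsmul_of_nsmul_eq {a : A} {n : ℕ} (h : n • a = (n + 1) • a) :
    n • a + n • a = n • a := by
  rw [← add_nsmul, add_nsmul_eq_of_nsmul_eq h]

theorem le_nsmul_self {n : ℕ} (hn : 1 ≤ n) (a : A) : a ≤ n • a := by
  obtain ⟨k, rfl⟩ := Nat.exists_eq_add_of_le hn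
  exact ⟨k • a, by rw [add_nsmul, one_nsmul]⟩

/-- `w` is below both `p ⊕ m (x ⊖ y)` and `q ⊕ n (y ⊖ x)` only if it is below `p ⊕ q`. -/
theorem le_add_of_le_add_nsmul_ominus {w p q x y : A} {m n : ℕ}
    (h₁ : w ≤ p + m • ominus x y) (h₂ : w ≤ q + n • ominus y x) : w ≤ p + q := by
  refine le_of_ominus_eq_zero
    (eq_zero_of_le_nsmul_ominus (m := m) (n := n) (x := x) (y := y) ?_ ?_)
  · refine ominus_le_iff.2 (h₁.trans ⟨q, ?_⟩)
    abel
  · refine ominus_le_iff.2 (h₂.trans ⟨p, ?_⟩)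
    abel

end MVAlgebra

/-! ### Prime separation -/

namespace MVIdeal

open MVAlgebra

variable {A : Type*} [MVAlgebra A]

/-- The zero ideal. -/
def zeroIdeal (A : Type*) [MVAlgebra A] : MVIdeal A where
  carrier := {0}
  zero_mem' := rfl
  mem_of_le' := by
    rintro x y rfl h
    exact eq_zero_of_le_zero h
  add_mem' := by
    rintro x y rfl rfl
    exact add_zero 0

/-- The ideal generated by an ideal `I` and an element `u`. -/
def adjoin (I : MVIdeal A) (u : A) : MVIdeal A where
  carrier := {z | ∃ p ∈ I, ∃ n : ℕ, z ≤ p + n • u}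
  zero_mem' := ⟨0, I.zero_mem', 0, zero_le' _⟩
  mem_of_le' := by
    rintro x y ⟨p, hp, n, h⟩ hy
    exact ⟨p, hp, n, hy.trans h⟩
  add_mem' := by
    rintro x y ⟨p, hp, m, h⟩ ⟨q, hq, n, h'⟩
    refine ⟨p + q, I.add_mem' _ _ hp hq, m + n, (add_le_add'' h h').trans (le_of_eq ?_)⟩
    rw [add_nsmul]
    abel

theorem subset_adjoin (I : MVIdeal A) (u : A) : I.carrier ⊆ (I.adjoin u).carrier :=
  fun z hz => ⟨z, hz, 0, ⟨_, rfl⟩⟩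

theorem self_mem_adjoin (I : MVIdeal A) (u : A) : u ∈ I.adjoin u :=
  ⟨0, I.zero_mem', 1, by rw [one_nsmul, zero_add]⟩

theorem nsmul_mem (I : MVIdeal A) {a : A} (ha : a ∈ I) (n : ℕ) : n • a ∈ I := by
  induction n with
  | zero =>
    rw [zero_nsmul]
    exact I.zero_mem'
  | succ n ih =>
    rw [succ_nsmul]
    exact I.add_mem' _ _ ih ha

/-- Each element outside an ideal `I` is outside some prime ideal that contains `I`. -/
theorem exists_isPrime (I : MVIdeal A) {a : A} (ha : a ∉ I) :
    ∃ P : MVIdeal A, P.IsPrime ∧ I.carrier ⊆ P.carrier ∧ a ∉ P := by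
  obtain ⟨_, hIM, ⟨⟨P, rfl, haP⟩, hmax⟩⟩ := zorn_subset_nonempty
    {S : Set A | ∃ J : MVIdeal A, J.carrier = S ∧ a ∉ J} (by
      intro c hc hchain hne
      refine ⟨⋃₀ c, ⟨⟨⋃₀ c, ?_, ?_, ?_⟩, rfl, ?_⟩, fun s hs => Set.subset_sUnion_of_mem hs⟩
      · obtain ⟨s, hs⟩ := hne
        obtain ⟨J, rfl, -⟩ := hc hs
        exact ⟨_, hs, J.zero_mem'⟩
      · rintro x y ⟨s, hs, hx⟩ hy
        obtain ⟨J, rfl, -⟩ := hc hs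
        exact ⟨_, hs, J.mem_of_le' x y hx hy⟩
      · rintro x y ⟨s, hs, hx⟩ ⟨t, ht, hy⟩
        rcases hchain.total hs ht with h | h
        · obtain ⟨J, rfl, -⟩ := hc ht
          exact ⟨_, ht, J.add_mem' x y (h hx) hy⟩
        · obtain ⟨J, rfl, -⟩ := hc hs
          exact ⟨_, hs, J.add_mem' x y hx (h hy)⟩
      · rintro ⟨s, hs, has⟩
        obtain ⟨J, rfl, haJ⟩ := hc hs
        exact haJ has)
    I.carrier ⟨I, rfl, ha⟩
  have hadj : ∀ u : A, u ∉ P → a ∈ P.adjoin u := by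
    intro u hu
    by_contra h
    exact hu (hmax ⟨P.adjoin u, rfl, h⟩ (P.subset_adjoin u) (P.self_mem_adjoin u))
  refine ⟨P, ⟨fun h => haP (P.mem_of_le' _ _ h (le_one' a)), fun x y => ?_⟩, hIM, haP⟩
  by_contra h
  obtain ⟨hx, hy⟩ := not_or.1 h
  obtain ⟨p, hp, m, hm⟩ := hadj _ hx
  obtain ⟨q, hq, n, hn⟩ := hadj _ hy
  exact haP (P.mem_of_le' _ _ (P.add_mem' _ _ hp hq) (le_add_of_le_add_nsmul_ominus hm hn))

/-! ### Classes modulo an ideal -/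

theorem cls_sup (I : MVIdeal A) (a b : A) : I.cls (a ⊔ b) = I.cls a ⊔ I.cls b := rfl

theorem cls_inf (I : MVIdeal A) (a b : A) : I.cls (a ⊓ b) = I.cls a ⊓ I.cls b := rfl

theorem cls_eq_zero {I : MVIdeal A} {a : A} (h : a ∈ I) : I.cls a = 0 := by
  rw [← cls_zero, cls_eq_cls, MVAlgebra.dist_zero]
  exact h

theorem cls_eq_one {I : MVIdeal A} {a : A} (h : neg a ∈ I) : I.cls a = 1 := by
  have h' := cls_eq_zero h
  rw [cls_neg] at h'
  rw [← neg_neg' (I.cls a), h']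
  rfl

end MVIdeal

/-! ### Idempotents and the spectrum -/

namespace PrimeSpec

open MVAlgebra

variable {A : Type*} [MVAlgebra A]

theorem one_notMem (P : PrimeSpec A) : (1 : A) ∉ P.1 := P.2.1

theorem mem_or_neg_mem (P : PrimeSpec A) {f : A} (hf : f + f = f) : f ∈ P.1 ∨ neg f ∈ P.1 := by
  rcases P.2.2 f (neg f) with h | h
  · refine Or.inl (P.1.mem_of_le' _ _ h ?_)
    rw [le_iff_neg_add, add_comm, ominus_add_comm, ominus_eq, neg_neg', hf, neg_add_self']
  · rw [ominus_eq, neg_neg', hf] at h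
    exact Or.inr h

theorem not_mem_of_neg_mem {P : PrimeSpec A} {f : A} (h : neg f ∈ P.1) : f ∉ P.1 := by
  intro hf
  have h1 := P.1.add_mem' _ _ h hf
  rw [neg_add_self'] at h1
  exact P.one_notMem h1

end PrimeSpec

/-! ### Injectivity and surjectivity of `η` -/

namespace MVAlgebra

variable {A : Type*} [MVAlgebra A]

theorem eta_injective : Function.Injective (eta A).toFun := by
  intro x y h
  by_contra hne
  have hd : dist x y ∉ MVIdeal.zeroIdeal A := fun h0 => hne (eq_of_dist_eq_zero h0)
  obtain ⟨P, hP, -, hxy⟩ := (MVIdeal.zeroIdeal A).exists_isPrime hd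
  exact hxy (MVIdeal.cls_eq_cls.1 (congrFun (congrArg Subtype.val h) ⟨P, hP⟩))

/-- In a hyperarchimedean algebra, each `W a` is `W f` for some idempotent `f`. -/
theorem IsHyperarchimedean.exists_idempotent (hA : IsHyperarchimedean A) (a : A) :
    ∃ f : A, f + f = f ∧ ∀ P : PrimeSpec A, f ∈ P.1 ↔ a ∈ P.1 := by
  obtain ⟨n, hn, h⟩ := hA a
  exact ⟨n • a, nsmul_add_nsmul_of_nsmul_eq h, fun P =>
    ⟨fun hf => P.1.mem_of_le' _ _ hf (le_nsmul_self hn a), fun ha => P.1.nsmul_mem ha n⟩⟩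

/-- For a section `σ`, the ideal of the elements `e` such that `σ` agrees with some `â` off `W e`. -/
def IsHyperarchimedean.extensionIdeal (hA : IsHyperarchimedean A)
    (σ : ∀ P : PrimeSpec A, P.1.Quot) : MVIdeal A where
  carrier := {e | ∃ a : A, ∀ Q : PrimeSpec A, e ∉ Q.1 → σ Q = Q.1.cls a}
  zero_mem' := ⟨0, fun Q h => (h Q.1.zero_mem').elim⟩
  mem_of_le' := by
    rintro x y ⟨a, ha⟩ hy
    exact ⟨a, fun Q hQ => ha Q fun hx => hQ (Q.1.mem_of_le' _ _ hx hy)⟩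
  add_mem' := by
    rintro x y ⟨a, ha⟩ ⟨b, hb⟩
    obtain ⟨f, hf, hfx⟩ := hA.exists_idempotent x
    refine ⟨(f ⊓ a) ⊔ (neg f ⊓ b), fun Q hQ => ?_⟩
    rw [MVIdeal.cls_sup, MVIdeal.cls_inf, MVIdeal.cls_inf]
    rcases Q.mem_or_neg_mem hf with h | h
    · have hx := (hfx Q).1 h
      have h' : neg (neg f) ∈ Q.1 := by rwa [neg_neg']
      rw [hb Q fun hy => hQ (Q.1.add_mem' _ _ hx hy), MVIdeal.cls_eq_zero h,
        MVIdeal.cls_eq_one h', zero_inf', one_inf',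
        zero_sup']
    · rw [ha Q fun hx => PrimeSpec.not_mem_of_neg_mem h ((hfx Q).2 hx), MVIdeal.cls_eq_zero h,
        MVIdeal.cls_eq_one h, zero_inf', one_inf',
        sup_zero']

theorem IsHyperarchimedean.eta_surjective (hA : IsHyperarchimedean A) :
    Function.Surjective (eta A).toFun := by
  intro σ
  have h1 : (1 : A) ∈ hA.extensionIdeal σ.1 := by
    by_contra h
    obtain ⟨P, hP, hsub, -⟩ := MVIdeal.exists_isPrime _ h
    obtain ⟨a, b, hb, hab⟩ := EtaleSpec.continuous_sectionOf_iff.1 σ.2 ⟨P, hP⟩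
    obtain ⟨f, hf, hfb⟩ := hA.exists_idempotent b
    have hn : neg f ∈ hA.extensionIdeal σ.1 := by
      refine ⟨a, fun Q hQ => hab Q ((hfb Q).1 ?_)⟩
      exact (Q.mem_or_neg_mem hf).resolve_right hQ
    exact PrimeSpec.not_mem_of_neg_mem (P := ⟨P, hP⟩) (hsub hn) ((hfb _).2 hb)
  obtain ⟨a, ha⟩ := h1
  exact ⟨a, Subtype.ext (funext fun Q => (ha Q Q.one_notMem).symm)⟩

end MVAlgebra

theorem MVHom.isIso_of_bijective {A B : Type*} [MVAlgebra A] [MVAlgebra B] (f : MVHom A B)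
    (hf : Function.Bijective f.toFun) : f.IsIso := by
  obtain ⟨g, hl, hr⟩ := Function.bijective_iff_has_inverse.1 hf
  refine ⟨⟨g, hf.1 ?_, fun x y => hf.1 ?_, fun x => hf.1 ?_⟩, hl, hr⟩
  · rw [hr, f.map_zero']
  · rw [hr, f.map_add', hr, hr]
  · rw [hr, f.map_neg', hr]

/-! ### The gluing formula -/

namespace EtaleSpec

open MVAlgebra

variable {A : Type*} [MVAlgebra A]

theorem hat_eq_hat_iff {a b : A} {P : PrimeSpec A} :
    hat a P = hat b P ↔ P.1.cls a = P.1.cls b :=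
  ⟨fun h => eq_of_heq (Sigma.mk.inj h).2, fun h => congrArg (Sigma.mk P) h⟩

theorem eqOn_hat_glue {a₁ a₂ b₁ b₂ : A} {n : ℕ} (hn : 1 ≤ n) (h₂ : n • a₂ = (n + 1) • a₂)
    (hb : Set.EqOn (hat b₁) (hat b₂) (PrimeSpec.W a₁ ∩ PrimeSpec.W a₂)) :
    Set.EqOn (hat ((b₁ ⊓ b₂) ⊔ (n • a₁ ⊓ b₂) ⊔ (n • a₂ ⊓ b₁))) (hat b₁) (PrimeSpec.W a₁) := by
  intro P hP
  rw [hat_eq_hat_iff]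
  simp only [MVIdeal.cls_sup, MVIdeal.cls_inf]
  rw [MVIdeal.cls_eq_zero (P.1.nsmul_mem hP n), zero_inf',
    sup_zero']
  rcases P.mem_or_neg_mem (nsmul_add_nsmul_of_nsmul_eq h₂) with h | h
  · have ha₂ : a₂ ∈ P.1 := P.1.mem_of_le' _ _ h (le_nsmul_self hn a₂)
    rw [← hat_eq_hat_iff.1 (hb ⟨hP, ha₂⟩), MVIdeal.cls_eq_zero h, zero_inf',
      inf_idem, sup_zero']
  · rw [MVIdeal.cls_eq_one h, one_inf', sup_eq_right.2 inf_le_left]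

end EtaleSpec

theorem theorem5 {A : Type*} [MVAlgebra A] (hA : MVAlgebra.IsHyperarchimedean A) :
    (MVAlgebra.eta A).IsIso ∧
    ∀ a₁ a₂ : A,
      (∃ n : ℕ, 1 ≤ n ∧ n • a₁ = (n + 1) • a₁ ∧ n • a₂ = (n + 1) • a₂) ∧
      ∀ n : ℕ, 1 ≤ n → n • a₁ = (n + 1) • a₁ → n • a₂ = (n + 1) • a₂ →
        ∀ b₁ b₂ : A,
          Set.EqOn (EtaleSpec.hat b₁) (EtaleSpec.hat b₂) (PrimeSpec.W a₁ ∩ PrimeSpec.W a₂) →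
          Set.EqOn (EtaleSpec.hat ((b₁ ⊓ b₂) ⊔ (n • a₁ ⊓ b₂) ⊔ (n • a₂ ⊓ b₁)))
              (EtaleSpec.hat b₁) (PrimeSpec.W a₁) ∧
            Set.EqOn (EtaleSpec.hat ((b₁ ⊓ b₂) ⊔ (n • a₁ ⊓ b₂) ⊔ (n • a₂ ⊓ b₁)))
              (EtaleSpec.hat b₂) (PrimeSpec.W a₂) := by
  refine ⟨(MVAlgebra.eta A).isIso_of_bijective
    ⟨MVAlgebra.eta_injective, hA.eta_surjective⟩, fun a₁ a₂ => ⟨?_, ?_⟩⟩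
  · obtain ⟨m, hm, h₁⟩ := hA a₁
    obtain ⟨n, -, h₂⟩ := hA a₂
    refine ⟨m + n, hm.trans (Nat.le_add_right m n), ?_, ?_⟩
    · rw [add_assoc, MVAlgebra.add_nsmul_eq_of_nsmul_eq h₁,
        MVAlgebra.add_nsmul_eq_of_nsmul_eq h₁]
    · rw [add_comm m n, add_assoc, MVAlgebra.add_nsmul_eq_of_nsmul_eq h₂,
        MVAlgebra.add_nsmul_eq_of_nsmul_eq h₂]
  · intro n hn h₁ h₂ b₁ b₂ hb
    refine ⟨EtaleSpec.eqOn_hat_glue hn h₂ hb, ?_⟩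
    -- The formula is symmetric under exchanging the indices `1` and `2`.
    rw [inf_comm b₁ b₂, sup_right_comm]
    refine EtaleSpec.eqOn_hat_glue hn h₁ ?_
    rw [Set.inter_comm]
    exact hb.symm
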